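/- All graphs are finite, undirected and simple. A graph is well-dominated if all of its (inclusion-)minimal dominating sets have the same cardinality, i.e. $\gamma=\Gamma$, where $\gamma$ is the smallest cardinality of a dominating set and $\Gamma$ the largest cardinality of a minimal dominating set. The direct product $G\times H$ has vertex set $V(G)\times V(H)$, with $(g_1,h_1)$ adjacent to $(g_2,h_2)$ exactly when $g_1g_2\in E(G)$ and $h_1h_2\in E(H)$. The corona $F\odot K_1$ is obtained from $F$ by adding, for each vertex $u$ of $F$, a new vertex $u'$ and the edge $uu'$. Theorem. Let $G$ and $H$ be connected graphs of order at least $2$. The direct product $G\times H$ is well-dominated if and only if it is isomorphic to $K_3\times K_3$, to $K_2\times C_4$, or to $K_2\times(F\odot K_1)$ for some connected graph $F$ (of order at least $1$; $F=K_1$ is allowed). -/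

import Mathlib

namespace SimpleGraph

/-- The closed neighborhood `N[A] = N(A) ∪ A` of a set of vertices. -/
def closedNbhd {V : Type*} (G : SimpleGraph V) (A : Set V) : Set V :=
  (⋃ v ∈ A, G.neighborSet v) ∪ A

/-- `D` is a dominating set of `G` if `N[D] = V(G)`. -/
def IsDominatingSet {V : Type*} (G : SimpleGraph V) (D : Set V) : Prop :=
  G.closedNbhd D = Set.univ

/-- `D` is a minimal dominating set: it is dominating and no proper subset of it is. -/
def IsMinimalDominatingSet {V : Type*} (G : SimpleGraph V) (D : Set V) : Prop :=
  G.IsDominatingSet D ∧ ∀ E : Set V, E ⊂ D → ¬ G.IsDominatingSet E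

/-- The domination number `γ(G)` of a finite graph: the minimum cardinality of a dominating set. -/
noncomputable def dominationNumber {V : Type*} (G : SimpleGraph V) : ℕ :=
  sInf {k | ∃ D : Set V, G.IsDominatingSet D ∧ D.ncard = k}

/-- The upper domination number `Γ(G)` of a finite graph: the maximum cardinality of a minimal
dominating set. -/
noncomputable def upperDominationNumber {V : Type*} (G : SimpleGraph V) : ℕ :=
  sSup {k | ∃ D : Set V, G.IsMinimalDominatingSet D ∧ D.ncard = k}

/-- A finite graph is well-dominated if `γ(G) = Γ(G)`. -/
def IsWellDominated {V : Type*} (G : SimpleGraph V) : Prop :=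
  G.dominationNumber = G.upperDominationNumber

/-- The direct (tensor) product of two graphs. -/
def directProd {V W : Type*} (G : SimpleGraph V) (H : SimpleGraph W) : SimpleGraph (V × W) where
  Adj x y := G.Adj x.1 y.1 ∧ H.Adj x.2 y.2
  symm := ⟨fun _ _ h => ⟨h.1.symm, h.2.symm⟩⟩
  loopless := ⟨fun _ h => G.irrefl h.1⟩

/-- The adjacency relation of the corona: `inl u` is the original vertex `u`, and `inr u` is the
new vertex `u'` attached to `u`. -/
def coronaAdj {V : Type*} (G : SimpleGraph V) : V ⊕ V → V ⊕ V → Prop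
  | Sum.inl u, Sum.inl v => G.Adj u v
  | Sum.inl u, Sum.inr v => u = v
  | Sum.inr u, Sum.inl v => u = v
  | Sum.inr _, Sum.inr _ => False

/-- The corona `G ⊙ K₁`. -/
def corona {V : Type*} (G : SimpleGraph V) : SimpleGraph (V ⊕ V) where
  Adj := G.coronaAdj
  symm := ⟨by
    rintro (u | u) (v | v) h
    · exact G.adj_symm h
    · exact Eq.symm h
    · exact Eq.symm h
    · exact h⟩
  loopless := ⟨by
    rintro (u | u) h
    · exact G.irrefl h
    · exact h⟩

end SimpleGraph

namespace SimpleGraph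

/-! ### Dominating sets and their two extremal numbers -/

variable {V W : Type*}

/-! Necessity uses one consequence of well-domination, `IsWellDominated.ncard_le`: if `A` is
independent and `N[A] ⊆ N[B]`, then `|A| ≤ |B|`. Indeed, extend `A` to a maximal independent set
`I`, which is a minimal dominating set; exchanging `A` for `B` in `I` leaves a dominating set. Each
excluded product is ruled out by a pair `A`, `B` violating this bound.

If `G = K₂`, a layer is independent, so no dominating set of `K₂ × H` is smaller than the order of
`H` (`DoubleCoverBound`). Hall's theorem then gives a permutation `σ` with `v ~ σ v`, and
`DoubleCoverBound.eq_of_adj` shows that an edge `v`–`σ v` without a leaf closes up to a 4-cycle,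
which is all of `H`. Otherwise `H` is a corona.

If both orders are at least 3, a leaf in one factor would force `DoubleCoverBound` on the other,
hence a 4-cycle or a corona; both are refuted by exchanges (`ExchangeBound.not_pendant`). Without
leaves, an induced path on three vertices in either factor is refuted too, so both factors are
complete. A product of complete graphs has a dominating set of 3 vertices, so both are `K₃`.

Conversely, `K₂ × (F ⊙ K₁)` is partitioned into pendant edges, and a minimal dominating set meets
each in exactly one vertex; the other two products are checked exhaustively. -/

theorem mem_closedNbhd {G : SimpleGraph V} {A : Set V} {x : V} :
    x ∈ G.closedNbhd A ↔ x ∈ A ∨ ∃ y ∈ A, G.Adj y x := by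
  simp [closedNbhd, or_comm]

theorem isDominatingSet_iff {G : SimpleGraph V} {A : Set V} :
    G.IsDominatingSet A ↔ ∀ x, x ∈ A ∨ ∃ y ∈ A, G.Adj y x := by
  simp only [IsDominatingSet, Set.eq_univ_iff_forall, mem_closedNbhd]

theorem dominationNumber_le {G : SimpleGraph V} {D : Set V} (hD : G.IsDominatingSet D) :
    G.dominationNumber ≤ D.ncard :=
  Nat.sInf_le ⟨D, hD, rfl⟩

theorem le_upperDominationNumber [Finite V] {G : SimpleGraph V} {D : Set V}
    (hD : G.IsMinimalDominatingSet D) : D.ncard ≤ G.upperDominationNumber := by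
  -- Boundedness matters: in `ℕ` the `sSup` of an unbounded set is 0.
  refine le_csSup ⟨Nat.card V, ?_⟩ ⟨D, hD, rfl⟩
  rintro _ ⟨E, -, rfl⟩
  exact Set.ncard_le_card E

theorem exists_isMinimalDominatingSet_ncard [Finite V] (G : SimpleGraph V) :
    ∃ D : Set V, G.IsMinimalDominatingSet D ∧ D.ncard = G.dominationNumber := by
  have hne : {k | ∃ D : Set V, G.IsDominatingSet D ∧ D.ncard = k}.Nonempty :=
    ⟨_, Set.univ, isDominatingSet_iff.2 fun x => Or.inl trivial, rfl⟩
  obtain ⟨D, hD, hc⟩ := Nat.sInf_mem hne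
  refine ⟨D, ⟨hD, fun E hE hdom => ?_⟩, hc⟩
  have h1 := Set.ncard_lt_ncard hE (Set.toFinite D)
  have h2 := dominationNumber_le hdom
  have h3 : D.ncard = G.dominationNumber := hc
  omega

theorem isWellDominated_of_forall_ncard_eq [Finite V] {G : SimpleGraph V} (k : ℕ)
    (h : ∀ D : Set V, G.IsMinimalDominatingSet D → D.ncard = k) : G.IsWellDominated := by
  obtain ⟨D, hD, hc⟩ := G.exists_isMinimalDominatingSet_ncard
  refine le_antisymm (hc ▸ le_upperDominationNumber hD) (csSup_le ⟨_, D, hD, rfl⟩ ?_)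
  rintro _ ⟨E, hE, rfl⟩
  rw [h E hE, ← hc, h D hD]

theorem IsMinimalDominatingSet.not_isDominatingSet_diff {G : SimpleGraph V} {D : Set V}
    (hD : G.IsMinimalDominatingSet D) {x : V} (hx : x ∈ D) : ¬ G.IsDominatingSet (D \ {x}) :=
  hD.2 _ (Set.sdiff_singleton_ssubset.2 hx)

/-! ### Invariance under isomorphism -/

section Iso

variable {G : SimpleGraph V} {H : SimpleGraph W}

theorem IsDominatingSet.image_iso (e : G ≃g H) {D : Set V} (hD : G.IsDominatingSet D) :
    H.IsDominatingSet (e '' D) := by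
  rw [isDominatingSet_iff] at *
  intro x
  rcases hD (e.symm x) with h | ⟨y, hy, hyx⟩
  · exact Or.inl ⟨_, h, by simp⟩
  · exact Or.inr ⟨e y, ⟨y, hy, rfl⟩, by simpa using e.map_adj_iff.2 hyx⟩

theorem isDominatingSet_image_iso (e : G ≃g H) {D : Set V} :
    H.IsDominatingSet (e '' D) ↔ G.IsDominatingSet D := by
  refine ⟨fun h => ?_, fun h => h.image_iso e⟩
  have h2 := h.image_iso e.symm
  rw [Set.image_image] at h2
  simpa using h2

theorem dominationNumber_eq_of_iso (e : G ≃g H) : G.dominationNumber = H.dominationNumber := by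
  unfold dominationNumber
  congr 1
  ext k
  constructor
  · rintro ⟨D, hD, rfl⟩
    exact ⟨e '' D, hD.image_iso e, Set.ncard_image_of_injective _ e.injective⟩
  · rintro ⟨D, hD, rfl⟩
    exact ⟨e.symm '' D, hD.image_iso e.symm, Set.ncard_image_of_injective _ e.symm.injective⟩

theorem IsMinimalDominatingSet.image_iso (e : G ≃g H) {D : Set V}
    (hD : G.IsMinimalDominatingSet D) : H.IsMinimalDominatingSet (e '' D) := by
  refine ⟨hD.1.image_iso e, fun E hE hdom => ?_⟩
  refine hD.2 (e ⁻¹' E) ?_ ?_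
  · have : e '' (e ⁻¹' E) = E := Set.image_preimage_eq _ e.surjective
    rw [← this] at hE
    exact (e.injective.injOn.image_ssubset_image_iff (Set.subset_univ _) (Set.subset_univ _)).1 hE
  · rw [← isDominatingSet_image_iso e, Set.image_preimage_eq _ e.surjective]
    exact hdom

theorem upperDominationNumber_eq_of_iso (e : G ≃g H) :
    G.upperDominationNumber = H.upperDominationNumber := by
  unfold upperDominationNumber
  congr 1
  ext k
  constructor
  · rintro ⟨D, hD, rfl⟩
    exact ⟨e '' D, hD.image_iso e, Set.ncard_image_of_injective _ e.injective⟩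
  · rintro ⟨D, hD, rfl⟩
    exact ⟨e.symm '' D, hD.image_iso e.symm, Set.ncard_image_of_injective _ e.symm.injective⟩

theorem IsWellDominated.of_iso (e : G ≃g H) (h : H.IsWellDominated) : G.IsWellDominated := by
  unfold IsWellDominated at *
  rw [dominationNumber_eq_of_iso e, upperDominationNumber_eq_of_iso e, h]

end Iso

/-- The factors of a direct product can be swapped. -/
def directProdComm (G : SimpleGraph V) (H : SimpleGraph W) :
    G.directProd H ≃g H.directProd G where
  toEquiv := Equiv.prodComm V W
  map_rel_iff' := and_comm

/-- The direct product of two isomorphisms. -/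
def directProdCongr {V' W' : Type*} {G : SimpleGraph V} {H : SimpleGraph W}
    {G' : SimpleGraph V'} {H' : SimpleGraph W'} (e : G ≃g G') (f : H ≃g H') :
    G.directProd H ≃g G'.directProd H' where
  toEquiv := Equiv.prodCongr e.toEquiv f.toEquiv
  map_rel_iff' := and_congr e.map_adj_iff f.map_adj_iff

/-! ### Independent sets and the exchange inequality -/

theorem exists_maximal_isIndepSet [Finite V] {G : SimpleGraph V} {A : Set V}
    (hA : G.IsIndepSet A) :
    ∃ I, A ⊆ I ∧ G.IsIndepSet I ∧ G.IsDominatingSet I := by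
  obtain ⟨I, hAI, hI⟩ := (Set.toFinite {A : Set V | G.IsIndepSet A}).exists_le_maximal hA
  refine ⟨I, hAI, hI.prop, isDominatingSet_iff.2 fun x => ?_⟩
  by_contra! hx
  refine hx.1 (hI.le_of_ge (y := insert x I) ?_ (Set.subset_insert x I) (Set.mem_insert x I))
  exact Set.Pairwise.insert hI.prop fun y hy _ => ⟨fun h => hx.2 y hy h.symm, hx.2 y hy⟩

theorem IsIndepSet.not_adj {G : SimpleGraph V} {A : Set V} (hA : G.IsIndepSet A) {x y : V}
    (hx : x ∈ A) (hy : y ∈ A) : ¬ G.Adj x y :=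
  fun h => hA hx hy h.ne h

theorem IsIndepSet.isMinimalDominatingSet {G : SimpleGraph V} {I : Set V} (hI : G.IsIndepSet I)
    (hdom : G.IsDominatingSet I) : G.IsMinimalDominatingSet I := by
  refine ⟨hdom, fun E hE hEdom => ?_⟩
  obtain ⟨x, hxI, hxE⟩ := Set.exists_of_ssubset hE
  rcases isDominatingSet_iff.1 hEdom x with h | ⟨y, hy, hyx⟩
  exacts [hxE h, hI.not_adj (hE.1 hy) hxI hyx]

/-- In a well-dominated graph an independent set is never larger than a set whose closed
neighborhood contains its own. -/
theorem IsWellDominated.ncard_le [Finite V] {G : SimpleGraph V} (h : G.IsWellDominated)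
    {A B : Set V} (hA : G.IsIndepSet A) (hAB : G.closedNbhd A ⊆ G.closedNbhd B) :
    A.ncard ≤ B.ncard := by
  obtain ⟨I, hAI, hI, hdom⟩ := exists_maximal_isIndepSet hA
  have h1 := le_upperDominationNumber (hI.isMinimalDominatingSet hdom)
  have h2 : G.IsDominatingSet (B ∪ I \ A) := by
    rw [isDominatingSet_iff] at *
    intro x
    have key : x ∈ G.closedNbhd A → x ∈ B ∪ I \ A ∨ ∃ y ∈ B ∪ I \ A, G.Adj y x := fun hx => by
      rcases mem_closedNbhd.1 (hAB hx) with h | ⟨y, hy, hyx⟩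
      exacts [Or.inl (Or.inl h), Or.inr ⟨y, Or.inl hy, hyx⟩]
    rcases hdom x with hx | ⟨y, hy, hyx⟩
    · by_cases hxA : x ∈ A
      · exact key (mem_closedNbhd.2 (Or.inl hxA))
      · exact Or.inl (Or.inr ⟨hx, hxA⟩)
    · by_cases hyA : y ∈ A
      · exact key (mem_closedNbhd.2 (Or.inr ⟨y, hyA, hyx⟩))
      · exact Or.inr ⟨y, Or.inr ⟨hy, hyA⟩, hyx⟩
  have h3 := dominationNumber_le h2
  have h4 := Set.ncard_union_le B (I \ A)
  have h5 := Set.ncard_sdiff_add_ncard_of_subset hAI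
  unfold IsWellDominated at h
  omega

/-- A nonempty set of vertices of a connected graph that is closed under adjacency contains every
vertex. -/
theorem Connected.mem_of_forall_adj {G : SimpleGraph V} (hG : G.Connected) {S : Set V} {x : V}
    (hx : x ∈ S) (hS : ∀ u ∈ S, ∀ v, G.Adj u v → v ∈ S) (y : V) : y ∈ S := by
  obtain ⟨p⟩ := hG.preconnected x y
  induction p with
  | nil => exact hx
  | cons h _ ih => exact ih (hS _ hx _ h)

theorem Connected.exists_adj [Nontrivial V] {G : SimpleGraph V} (hG : G.Connected) (x : V) :
    ∃ y, G.Adj x y := by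
  by_contra! h
  obtain ⟨z, hz⟩ := exists_ne x
  exact hz (hG.mem_of_forall_adj (S := {x}) rfl
    (by rintro u rfl v huv; exact absurd huv (h v)) z)

/-! ### Graphs partitioned into pendant edges, and coronas -/

section Pendant

variable {X : SimpleGraph W} {ι : Type*} {f l : ι → W}

/-- A graph whose vertices are partitioned into pairs, each made of a vertex `l i` of degree one
and its neighbor `f i`, is well-dominated. -/
theorem isWellDominated_of_pendant [Finite W] (hfl : Function.Bijective (Sum.elim f l))
    (hl : ∀ i y, X.Adj (l i) y ↔ y = f i) : X.IsWellDominated := by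
  have hf_inj : Function.Injective f := fun i j h => by
    simpa using @hfl.1 (Sum.inl i) (Sum.inl j) h
  have hl_inj : Function.Injective l := fun i j h => by
    simpa using @hfl.1 (Sum.inr i) (Sum.inr j) h
  have hne : ∀ i j, f i ≠ l j := fun i j h => by
    simpa using @hfl.1 (Sum.inl i) (Sum.inr j) h
  have hcase : ∀ x, (∃ i, f i = x) ∨ ∃ i, l i = x := fun x => by
    obtain ⟨i | i, rfl⟩ := hfl.2 x
    exacts [Or.inl ⟨i, rfl⟩, Or.inr ⟨i, rfl⟩]
  refine isWellDominated_of_forall_ncard_eq (Nat.card ι) fun D hD => ?_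
  have hone : ∀ i, f i ∈ D ∨ l i ∈ D := fun i => by
    rcases isDominatingSet_iff.1 hD.1 (l i) with h | ⟨y, hy, hyx⟩
    · exact Or.inr h
    · exact Or.inl ((hl i y).1 hyx.symm ▸ hy)
  -- The leaf `l i` dominates only itself and `f i`, so next to `f i` it is redundant.
  have htwo : ∀ i, ¬ (f i ∈ D ∧ l i ∈ D) := by
    rintro i ⟨hfi, hli⟩
    refine hD.not_isDominatingSet_diff hli (isDominatingSet_iff.2 fun x => ?_)
    rcases isDominatingSet_iff.1 hD.1 x with h | ⟨y, hy, hyx⟩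
    · by_cases hx : x = l i
      · subst hx
        exact Or.inr ⟨f i, ⟨hfi, hne i i⟩, ((hl i _).2 rfl).symm⟩
      · exact Or.inl ⟨h, hx⟩
    · by_cases hyi : y = l i
      · subst hyi
        rw [hl] at hyx
        subst hyx
        exact Or.inl ⟨hfi, hne i i⟩
      · exact Or.inr ⟨y, ⟨hy, hyi⟩, hyx⟩
  classical
  have hD_eq : D = (fun i => if f i ∈ D then f i else l i) '' Set.univ := by
    ext x
    constructor
    · intro hx
      rcases hcase x with ⟨i, rfl⟩ | ⟨i, rfl⟩
      · exact ⟨i, trivial, by simp [hx]⟩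
      · exact ⟨i, trivial, if_neg fun h => htwo i ⟨h, hx⟩⟩
    · rintro ⟨i, -, rfl⟩
      dsimp only
      split_ifs with h
      exacts [h, (hone i).resolve_left h]
  have hinj : Function.Injective (fun i => if f i ∈ D then f i else l i) := fun i j h => by
    dsimp only at h
    split_ifs at h
    exacts [hf_inj h, absurd h (hne _ _), absurd h.symm (hne _ _), hl_inj h]
  rw [hD_eq, Set.ncard_image_of_injective _ hinj, Set.ncard_univ]

theorem Connected.of_corona {F : SimpleGraph V} (h : F.corona.Connected) : F.Connected := by
  have hne : Nonempty V := by
    obtain ⟨x | x⟩ := h.nonempty <;> exact ⟨x⟩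
  refine ⟨fun u v => ?_⟩
  refine h.mem_of_forall_adj (S := {x | F.Reachable u (Sum.elim id id x)}) (x := Sum.inl u)
    (Reachable.refl u) ?_ (Sum.inl v)
  rintro (a | a) ha (b | b) hab
  · exact Reachable.trans ha (Adj.reachable hab)
  · exact (show a = b from hab) ▸ ha
  · exact (show a = b from hab) ▸ ha
  · exact hab.elim

/-- A leaf sees only its partner, so all remaining edges lie among the `f i`; the base graph is the
one induced there. -/
theorem nonempty_iso_corona_of_pendant (hfl : Function.Bijective (Sum.elim f l))
    (hl : ∀ i y, X.Adj (l i) y ↔ y = f i) : Nonempty (X ≃g (X.comap f).corona) := by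
  have hf_inj : Function.Injective f := fun i j h => by
    simpa using @hfl.1 (Sum.inl i) (Sum.inl j) h
  have hne : ∀ i j, f i ≠ l j := fun i j h => by
    simpa using @hfl.1 (Sum.inl i) (Sum.inr j) h
  refine ⟨Iso.symm ⟨Equiv.ofBijective _ hfl, ?_⟩⟩
  rintro (i | i) (j | j)
  · exact Iff.rfl
  · change X.Adj (f i) (l j) ↔ i = j
    rw [adj_comm, hl, hf_inj.eq_iff]
  · change X.Adj (l i) (f j) ↔ i = j
    rw [hl, hf_inj.eq_iff, eq_comm]
  · change X.Adj (l i) (l j) ↔ False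
    rw [hl, iff_false]
    exact (hne _ _).symm

theorem Connected.exists_iso_corona_of_pendant [Finite W] (hX : X.Connected)
    (hfl : Function.Bijective (Sum.elim f l)) (hl : ∀ i y, X.Adj (l i) y ↔ y = f i) :
    ∃ (n : ℕ) (F : SimpleGraph (Fin n)), F.Connected ∧ Nonempty (X ≃g F.corona) := by
  have : Finite (ι ⊕ ι) := Finite.of_injective _ hfl.1
  have : Finite ι := Finite.sum_left ι
  let e := (Finite.equivFin ι).symm
  have hfl' : Function.Bijective (Sum.elim (f ∘ e) (l ∘ e)) := by
    rw [← Sum.elim_comp_map]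
    exact hfl.comp (Equiv.sumCongr e e).bijective
  obtain ⟨φ⟩ := nonempty_iso_corona_of_pendant hfl' fun i y => hl (e i) y
  exact ⟨_, _, (φ.connected_iff.1 hX).of_corona, ⟨φ⟩⟩

end Pendant

theorem isWellDominated_directProd_corona [Finite V] (F : SimpleGraph V) :
    ((⊤ : SimpleGraph (Fin 2)).directProd F.corona).IsWellDominated := by
  -- Adjacency switches layers, so the leaf over `a` attached to `(i, a)` lies in layer `1 - i`.
  refine isWellDominated_of_pendant (ι := Fin 2 × V) (f := fun p => (p.1, Sum.inl p.2))
    (l := fun p => (1 - p.1, Sum.inr p.2)) ⟨?_, ?_⟩ ?_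
  · rintro (⟨i, a⟩ | ⟨i, a⟩) (⟨j, b⟩ | ⟨j, b⟩) h <;> simp_all
  · rintro ⟨i, a | a⟩
    · exact ⟨Sum.inl (i, a), rfl⟩
    · exact ⟨Sum.inr (1 - i, a), by simp⟩
  · rintro ⟨i, a⟩ ⟨j, b | b⟩
    · change (1 - i ≠ j ∧ a = b) ↔ _
      simp only [Prod.mk.injEq, Sum.inl.injEq, eq_comm (a := a)]
      refine and_congr_left fun _ => ?_
      revert i j
      decide
    · change (1 - i ≠ j ∧ False) ↔ _
      simp


/-! ### Exhaustive check of the two exceptional products -/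

section FiniteCheck

theorem isWellDominated_of_forall_indicator [Fintype V] [DecidableEq V]
    {G : SimpleGraph V} (k : ℕ)
    (h : ∀ p : V → Bool, (∀ x, p x = true ∨ ∃ y, G.Adj y x ∧ p y = true) →
      (∀ z, p z = true → ¬ ∀ x, Function.update p z false x = true ∨
        ∃ y, G.Adj y x ∧ Function.update p z false y = true) →
      ∑ x, (p x).toNat = k) : G.IsWellDominated := by
  classical
  refine isWellDominated_of_forall_ncard_eq k fun D hD => ?_
  rw [← h (fun x => decide (x ∈ D)) (fun x => ?_) (fun z hz hdom => ?_),
    Set.ncard_eq_toFinset_card']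
  · simp [Bool.toNat, Bool.cond_decide, Finset.sum_boole, Set.toFinset]
  · simpa [and_comm] using isDominatingSet_iff.1 hD.1 x
  · refine hD.not_isDominatingSet_diff (of_decide_eq_true hz) (isDominatingSet_iff.2 fun x => ?_)
    simpa [Function.update_apply, and_comm] using hdom x

/-- Domination in `K₃ × K₃`, for the indicator function of a set listed row by row. -/
def domK3K3 (a b c d e f g h i : Bool) : Bool :=
  (a || e || f || h || i) && (b || d || f || g || i) && (c || d || e || g || h) &&
  (d || b || c || h || i) && (e || a || c || g || i) && (f || a || b || g || h) &&
  (g || b || c || e || f) && (h || a || c || d || f) && (i || a || b || d || e)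

/-- Each of the 512 subsets fails to dominate, still dominates after one deletion, or has 3
elements. -/
theorem card_eq_three_of_domK3K3 : ∀ a b c d e f g h i : Bool,
    (!domK3K3 a b c d e f g h i || (a && domK3K3 false b c d e f g h i) ||
      (b && domK3K3 a false c d e f g h i) || (c && domK3K3 a b false d e f g h i) ||
      (d && domK3K3 a b c false e f g h i) || (e && domK3K3 a b c d false f g h i) ||
      (f && domK3K3 a b c d e false g h i) || (g && domK3K3 a b c d e f false h i) ||
      (h && domK3K3 a b c d e f g false i) || (i && domK3K3 a b c d e f g h false) ||
      (a.toNat + (b.toNat + (c.toNat + (d.toNat + (e.toNat + (f.toNat + (g.toNat + (h.toNat +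
        i.toNat))))))) == 3)) = true := by
  decide +kernel

theorem domK3K3_iff (p : Fin 3 × Fin 3 → Bool) :
    (∀ x, p x = true ∨ ∃ y, ((⊤ : SimpleGraph (Fin 3)).directProd ⊤).Adj y x ∧ p y = true) ↔
      domK3K3 (p (0, 0)) (p (0, 1)) (p (0, 2)) (p (1, 0)) (p (1, 1)) (p (1, 2))
        (p (2, 0)) (p (2, 1)) (p (2, 2)) = true := by
  simp [directProd, domK3K3, Prod.forall, Prod.exists, Fin.forall_fin_succ, Fin.exists_fin_succ,
    or_assoc, and_assoc]

theorem isWellDominated_K3_K3 :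
    ((⊤ : SimpleGraph (Fin 3)).directProd (⊤ : SimpleGraph (Fin 3))).IsWellDominated := by
  refine isWellDominated_of_forall_indicator 3 fun p hp hmin => ?_
  simp only [domK3K3_iff] at hp hmin
  have key := card_eq_three_of_domK3K3 (p (0, 0)) (p (0, 1)) (p (0, 2)) (p (1, 0)) (p (1, 1))
    (p (1, 2)) (p (2, 0)) (p (2, 1)) (p (2, 2))
  have h00 := hmin (0, 0)
  have h01 := hmin (0, 1)
  have h02 := hmin (0, 2)
  have h10 := hmin (1, 0)
  have h11 := hmin (1, 1)
  have h12 := hmin (1, 2)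
  have h20 := hmin (2, 0)
  have h21 := hmin (2, 1)
  have h22 := hmin (2, 2)
  simp at h00 h01 h02 h10 h11 h12 h20 h21 h22
  -- This restores the Boolean conjunctions of `key`, so that each non-minimality disjunct rewrites
  -- to `false`.
  simp only [← Bool.and_eq_false_imp] at h00 h01 h02 h10 h11 h12 h20 h21 h22
  simp only [hp, h00, h01, h02, h10, h11, h12, h20, h21, h22, Bool.not_true,
    Bool.false_or, beq_iff_eq] at key
  simpa [Fintype.sum_prod_type, Fin.sum_univ_succ, add_assoc] using key

/-- Domination in `K₂ × C₄`, for the indicator function of a set listed row by row. -/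
def domK2C4 (a b c d e f g h : Bool) : Bool :=
  (a || f || h) && (b || e || g) && (c || f || h) && (d || e || g) &&
  (e || b || d) && (f || a || c) && (g || b || d) && (h || a || c)

theorem card_eq_four_of_domK2C4 : ∀ a b c d e f g h : Bool,
    (!domK2C4 a b c d e f g h || (a && domK2C4 false b c d e f g h) ||
      (b && domK2C4 a false c d e f g h) || (c && domK2C4 a b false d e f g h) ||
      (d && domK2C4 a b c false e f g h) || (e && domK2C4 a b c d false f g h) ||
      (f && domK2C4 a b c d e false g h) || (g && domK2C4 a b c d e f false h) ||
      (h && domK2C4 a b c d e f g false) ||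
      (a.toNat + (b.toNat + (c.toNat + (d.toNat + (e.toNat + (f.toNat + (g.toNat +
        h.toNat)))))) == 4)) = true := by
  decide +kernel

theorem domK2C4_iff (p : Fin 2 × Fin 4 → Bool) :
    (∀ x, p x = true ∨
      ∃ y, ((⊤ : SimpleGraph (Fin 2)).directProd (cycleGraph 4)).Adj y x ∧ p y = true) ↔
      domK2C4 (p (0, 0)) (p (0, 1)) (p (0, 2)) (p (0, 3)) (p (1, 0)) (p (1, 1)) (p (1, 2))
        (p (1, 3)) = true := by
  have h : ∀ i j : Fin 4, (cycleGraph 4).Adj i j ↔ ![![false, true, false, true],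
    ![true, false, true, false], ![false, true, false, true], ![true, false, true, false]] i j
      = true := by decide
  simp only [directProd, h]
  simp [domK2C4, Prod.forall, Prod.exists, Fin.forall_fin_succ, Fin.exists_fin_succ,
    or_assoc, and_assoc]

theorem isWellDominated_K2_C4 :
    ((⊤ : SimpleGraph (Fin 2)).directProd (cycleGraph 4)).IsWellDominated := by
  refine isWellDominated_of_forall_indicator 4 fun p hp hmin => ?_
  simp only [domK2C4_iff] at hp hmin
  have key := card_eq_four_of_domK2C4 (p (0, 0)) (p (0, 1)) (p (0, 2)) (p (0, 3)) (p (1, 0))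
    (p (1, 1)) (p (1, 2)) (p (1, 3))
  have h00 := hmin (0, 0)
  have h01 := hmin (0, 1)
  have h02 := hmin (0, 2)
  have h03 := hmin (0, 3)
  have h10 := hmin (1, 0)
  have h11 := hmin (1, 1)
  have h12 := hmin (1, 2)
  have h13 := hmin (1, 3)
  simp at h00 h01 h02 h03 h10 h11 h12 h13
  simp only [← Bool.and_eq_false_imp] at h00 h01 h02 h03 h10 h11 h12 h13
  simp only [hp, h00, h01, h02, h03, h10, h11, h12, h13, Bool.not_true,
    Bool.false_or, beq_iff_eq] at key
  simpa [Fintype.sum_prod_type, Fin.sum_univ_succ, add_assoc] using key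

end FiniteCheck

/-! ### Consequences of the exchange bound for products -/

/-- No independent set is larger than a set whose closed
neighborhood contains its own. -/
def ExchangeBound (X : SimpleGraph V) : Prop :=
  ∀ A B : Set V, X.IsIndepSet A → X.closedNbhd A ⊆ X.closedNbhd B → A.ncard ≤ B.ncard

theorem IsWellDominated.exchangeBound [Finite V] {X : SimpleGraph V} (h : X.IsWellDominated) :
    X.ExchangeBound :=
  fun _ _ hA hAB => h.ncard_le hA hAB

theorem ExchangeBound.ncard_le_of_isDominatingSet {X : SimpleGraph V} (h : X.ExchangeBound)
    {A B : Set V} (hA : X.IsIndepSet A) (hB : X.IsDominatingSet B) : A.ncard ≤ B.ncard :=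
  h A B hA (hB.symm ▸ Set.subset_univ _)

/-- `K₂ × H` has domination number at least the order of `H`, in terms of the two layers of a
dominating set. -/
def DoubleCoverBound (H : SimpleGraph W) : Prop :=
  ∀ B₀ B₁ : Set W, (∀ x, x ∈ B₀ ∨ ∃ y ∈ B₁, H.Adj y x) → (∀ x, x ∈ B₁ ∨ ∃ y ∈ B₀, H.Adj y x) →
    Nat.card W ≤ B₀.ncard + B₁.ncard

theorem isIndepSet_prod_univ {G : SimpleGraph V} {H : SimpleGraph W} {A : Set V}
    (hA : G.IsIndepSet A) : (G.directProd H).IsIndepSet (A ×ˢ Set.univ) :=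
  fun _ hx _ hy _ h => hA.not_adj hx.1 hy.1 h.1

theorem isIndepSet_pair {G : SimpleGraph V} {x y : V} (h : ¬ G.Adj x y) :
    G.IsIndepSet {x, y} := by
  rintro u (rfl | rfl) v (rfl | rfl) _ huv
  exacts [G.irrefl huv, h huv, h huv.symm, G.irrefl huv]

theorem ncard_prod_univ [Finite V] [Finite W] (A : Set V) :
    (A ×ˢ (Set.univ : Set W)).ncard = A.ncard * Nat.card W := by
  rw [Set.ncard_prod, Set.ncard_univ]

theorem isDominatingSet_prod_univ {G : SimpleGraph V} {H : SimpleGraph W}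
    (hH : ∀ w, ∃ w', H.Adj w w') {A : Set V} (hA : G.IsDominatingSet A) :
    (G.directProd H).IsDominatingSet (A ×ˢ Set.univ) := by
  rw [isDominatingSet_iff] at *
  rintro ⟨x, w⟩
  rcases hA x with h | ⟨y, hy, hyx⟩
  · exact Or.inl ⟨h, trivial⟩
  · obtain ⟨w', hw⟩ := hH w
    exact Or.inr ⟨(y, w'), ⟨hy, trivial⟩, hyx, hw.symm⟩

/-- The independent set `(J ∪ {p}) × W` is compared with the dominating set `J × W ∪ {p} × B₀ ∪ {q}
× B₁`; the common part `J × W` cancels. For `G = K₂` one takes `J = ∅`. -/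
theorem ExchangeBound.doubleCoverBound [Finite V] [Finite W] {G : SimpleGraph V}
    {H : SimpleGraph W} (hH : ∀ w, ∃ w', H.Adj w w') (h : (G.directProd H).ExchangeBound)
    {p q : V} (hpq : G.Adj p q) {J : Set V} (hpJ : p ∉ J) (hJ : G.IsIndepSet (insert p J))
    (hdom : ∀ x, x = p ∨ x = q ∨ x ∈ J ∨ ∃ y ∈ J, G.Adj y x) : H.DoubleCoverBound := by
  intro B₀ B₁ h₀ h₁
  have hB : (G.directProd H).IsDominatingSet
      (J ×ˢ Set.univ ∪ ({p} ×ˢ B₀ ∪ {q} ×ˢ B₁)) := by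
    rw [isDominatingSet_iff]
    rintro ⟨x, w⟩
    rcases hdom x with rfl | rfl | hx | ⟨y, hy, hyx⟩
    · rcases h₀ w with hw | ⟨w', hw', hww⟩
      · exact Or.inl (Or.inr (Or.inl ⟨rfl, hw⟩))
      · exact Or.inr ⟨(q, w'), Or.inr (Or.inr ⟨rfl, hw'⟩), hpq.symm, hww⟩
    · rcases h₁ w with hw | ⟨w', hw', hww⟩
      · exact Or.inl (Or.inr (Or.inr ⟨rfl, hw⟩))
      · exact Or.inr ⟨(p, w'), Or.inr (Or.inl ⟨rfl, hw'⟩), hpq, hww⟩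
    · exact Or.inl (Or.inl ⟨hx, trivial⟩)
    · obtain ⟨w', hw⟩ := hH w
      exact Or.inr ⟨(y, w'), Or.inl ⟨hy, trivial⟩, hyx, hw.symm⟩
  have h1 := h.ncard_le_of_isDominatingSet (isIndepSet_prod_univ hJ) hB
  have h2 := Set.ncard_union_le (J ×ˢ (Set.univ : Set W)) ({p} ×ˢ B₀ ∪ {q} ×ˢ B₁)
  have h3 := Set.ncard_union_le ({p} ×ˢ B₀) ({q} ×ˢ B₁)
  rw [ncard_prod_univ, Set.ncard_insert_of_notMem hpJ] at h1
  rw [ncard_prod_univ] at h2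
  simp only [Set.ncard_prod, Set.ncard_singleton, one_mul] at h3
  linarith

/-! ### Graphs satisfying `DoubleCoverBound` -/

section DoubleCover

variable [Finite W] {H : SimpleGraph W}

theorem DoubleCoverBound.exists_perm (h : H.DoubleCoverBound) (hH : ∀ w, ∃ w', H.Adj w w') :
    ∃ σ : Equiv.Perm W, ∀ v, H.Adj v (σ v) := by
  classical
  have := Fintype.ofFinite W
  have hall : ∀ A : Finset W, A.card ≤ (A.biUnion fun v => H.neighborFinset v).card := by
    intro A
    -- Hall's condition comes from `B₀ = Aᶜ`, `B₁ = N(A)`: a vertex outside `N(A)` has all its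
    -- neighbors in `Aᶜ`.
    have key := h (↑Aᶜ) (↑(A.biUnion fun v => H.neighborFinset v)) ?_ ?_
    · rw [Set.ncard_coe_finset, Set.ncard_coe_finset, Finset.card_compl, Nat.card_eq_fintype_card]
        at key
      have := A.card_le_univ
      omega
    · intro x
      by_cases hx : x ∈ A
      · obtain ⟨y, hy⟩ := hH x
        exact Or.inr ⟨y, by simpa using ⟨x, hx, hy⟩, hy.symm⟩
      · exact Or.inl (by simpa using hx)
    · intro x
      by_cases hx : ∃ a ∈ A, H.Adj a x
      · exact Or.inl (by simpa using hx)
      · push Not at hx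
        obtain ⟨y, hy⟩ := hH x
        exact Or.inr ⟨y, by simpa using fun hyA => hx y hyA hy.symm, hy.symm⟩
  obtain ⟨f, hf, hfmem⟩ :=
    (Finset.all_card_le_biUnion_card_iff_exists_injective fun v => H.neighborFinset v).1 hall
  exact ⟨Equiv.ofBijective f (Finite.injective_iff_bijective.1 hf), fun v => by
    simpa using hfmem v⟩

/-- Otherwise `B₀ = W \ {v, σ⁻¹ w}` and `B₁ = {w}` dominate with `|W| - 1` vertices. The vertex `w`
covers the two omitted ones; in the other layer `x ≠ w` is covered by `σ⁻¹ x`, except that `σ v`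
needs `u`. -/
theorem DoubleCoverBound.eq_of_adj (h : H.DoubleCoverBound) {σ : Equiv.Perm W}
    (hσ : ∀ v, H.Adj v (σ v)) {v w u : W} (hvw : H.Adj v w) (hw : w ≠ σ v)
    (hu : H.Adj (σ v) u) (huv : u ≠ v) : w = σ u := by
  by_contra hne
  have hv : v ≠ σ.symm w := fun h => hw (by simp [h])
  have key := h ({v, σ.symm w}ᶜ) {w} ?_ ?_
  · have h1 := Set.ncard_add_ncard_compl ({v, σ.symm w} : Set W)
    rw [Set.ncard_pair hv] at h1
    rw [Set.ncard_singleton] at key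
    omega
  · intro x
    by_cases hx : x ∈ ({v, σ.symm w} : Set W)
    · right
      rcases hx with rfl | rfl
      · exact ⟨w, rfl, hvw.symm⟩
      · exact ⟨w, rfl, by simpa using (hσ (σ.symm w)).symm⟩
    · exact Or.inl hx
  · intro x
    by_cases hxw : x = w
    · exact Or.inl hxw
    · right
      by_cases hxv : x = σ v
      · refine ⟨u, ?_, hxv ▸ hu.symm⟩
        rintro (hh | hh)
        · exact huv hh
        · exact hne (by simp [Set.mem_singleton_iff.1 hh])
      · refine ⟨σ.symm x, ?_, by simpa using hσ (σ.symm x)⟩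
        rintro (hh | hh)
        · exact hxv (by simp [← hh])
        · exact hxw (σ.symm.injective hh)

/-- Apart from the 4-cycle, the only connected graphs meeting `DoubleCoverBound` are those with a
perfect matching in which every edge has an end of degree one. -/
theorem DoubleCoverBound.cycleGraph_or_pendant [Nontrivial W] (hH : H.Connected)
    (h : H.DoubleCoverBound) : Nonempty (H ≃g cycleGraph 4) ∨
      ∃ σ : Equiv.Perm W, ∀ v, (∀ y, H.Adj v y ↔ y = σ v) ∨ ∀ y, H.Adj (σ v) y ↔ y = v := by
  obtain ⟨σ, hσ⟩ := h.exists_perm hH.exists_adj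
  rw [or_iff_not_imp_right]
  intro hno
  push Not at hno
  obtain ⟨v, hv1, hv2⟩ := hno σ
  have hw : ∃ w, H.Adj v w ∧ w ≠ σ v := by
    by_contra! hc
    obtain ⟨y, hy⟩ := hv1
    rcases hy with hy | ⟨hy, rfl⟩
    exacts [hy.2 (hc y hy.1), hy (hσ v)]
  have hu : ∃ u, H.Adj (σ v) u ∧ u ≠ v := by
    by_contra! hc
    obtain ⟨y, hy⟩ := hv2
    rcases hy with hy | ⟨hy, rfl⟩
    exacts [hy.2 (hc y hy.1), hy (hσ y).symm]
  obtain ⟨w, hvw, hw⟩ := hw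
  obtain ⟨u, hsu, huv⟩ := hu
  have hwu : w = σ u := h.eq_of_adj hσ hvw hw hsu huv
  have huw : H.Adj u w := hwu ▸ hσ u
  -- Applying `eq_of_adj` to `v`–`σ v` and to `u`–`σ u = w` bounds all four neighborhoods, so these
  -- vertices form a whole component.
  have nv : ∀ y, H.Adj v y → y = σ v ∨ y = w := fun y hy => or_iff_not_imp_left.2 fun hne =>
    (h.eq_of_adj hσ hy hne hsu huv).trans hwu.symm
  have nsv : ∀ y, H.Adj (σ v) y → y = v ∨ y = u := fun y hy => or_iff_not_imp_left.2 fun hne =>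
    σ.injective ((h.eq_of_adj hσ hvw hw hy hne).symm.trans hwu)
  have nu : ∀ y, H.Adj u y → y = w ∨ y = σ v := fun y hy => or_iff_not_imp_left.2 fun hne =>
    h.eq_of_adj hσ hy (hwu ▸ hne) (hwu ▸ hvw.symm) huv.symm
  have nw : ∀ y, H.Adj w y → y = u ∨ y = v := fun y hy => or_iff_not_imp_left.2 fun hne =>
    (σ.injective (h.eq_of_adj hσ hsu.symm (hwu ▸ hw.symm) (hwu ▸ hy) hne)).symm
  have hvs := hσ v
  have hall := hH.mem_of_forall_adj (S := {v, σ v, u, w}) (x := v) (by simp) (by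
    rintro x (rfl | rfl | rfl | rfl) y hy
    · rcases nv y hy with rfl | rfl <;> simp
    · rcases nsv y hy with rfl | rfl <;> simp
    · rcases nu y hy with rfl | rfl <;> simp
    · rcases nw y hy with rfl | rfl <;> simp)
  have hnvu : ¬ H.Adj v u := fun hh => by
    rcases nv u hh with rfl | rfl
    exacts [H.irrefl hsu, H.irrefl huw]
  have hnsw : ¬ H.Adj (σ v) w := fun hh => by
    rcases nsv w hh with rfl | rfl
    exacts [H.irrefl hvw, H.irrefl huw]
  generalize σ v = s at *
  have hbij : Function.Bijective ![v, s, u, w] := by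
    constructor
    · intro i j hij
      have := hvs.ne
      have := hvw.ne
      have := hsu.ne
      have := huw.ne
      fin_cases i <;> fin_cases j <;> simp_all
    · intro x
      rcases hall x with rfl | rfl | rfl | rfl
      exacts [⟨0, rfl⟩, ⟨1, rfl⟩, ⟨2, rfl⟩, ⟨3, rfl⟩]
  have hadj : ∀ i j : Fin 4, (cycleGraph 4).Adj i j ↔ ![![false, true, false, true],
    ![true, false, true, false], ![false, true, false, true], ![true, false, true, false]] i j
      = true := by decide
  refine ⟨Iso.symm ⟨Equiv.ofBijective _ hbij, ?_⟩⟩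
  intro i j
  rw [hadj]
  fin_cases i <;> fin_cases j <;>
    simp [hvs, hvw, hsu, huw, hnvu, hnsw, hvs.symm, hvw.symm, hsu.symm, huw.symm,
      H.adj_comm u v, H.adj_comm w s]

end DoubleCover

variable {G : SimpleGraph V} {H : SimpleGraph W}

/-- A connected graph with a perfect matching in which every edge has an end of degree one is the
corona of a connected graph. -/
theorem Connected.exists_iso_corona_of_perm [Finite W] [Nontrivial W] (hH : H.Connected)
    {σ : Equiv.Perm W} (hσ : ∀ v, (∀ y, H.Adj v y ↔ y = σ v) ∨ ∀ y, H.Adj (σ v) y ↔ y = v) :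
    ∃ (n : ℕ) (F : SimpleGraph (Fin n)), F.Connected ∧ Nonempty (H ≃g F.corona) := by
  have hadj : ∀ v, H.Adj v (σ v) := fun v => by
    rcases hσ v with h | h
    exacts [(h _).2 rfl, ((h _).2 rfl).symm]
  -- When both ends of a matching edge are leaves, the graph is `K₂` and the base vertex has to be
  -- chosen by hand; otherwise the base vertices are exactly the non-leaves.
  by_cases hK : ∃ v, (∀ y, H.Adj v y ↔ y = σ v) ∧ ∀ y, H.Adj (σ v) y ↔ y = v
  · obtain ⟨v, h1, h2⟩ := hK
    have hall := hH.mem_of_forall_adj (S := {v, σ v}) (x := v) (by simp) (by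
      rintro x (rfl | rfl) y hy
      · exact Or.inr ((h1 y).1 hy)
      · exact Or.inl ((h2 y).1 hy))
    refine hH.exists_iso_corona_of_pendant (ι := Unit) (f := fun _ => v) (l := fun _ => σ v)
      ⟨?_, ?_⟩ fun _ => h2
    · have := (hadj v).ne
      rintro (_ | _) (_ | _) h <;> simp_all
    · intro x
      rcases hall x with rfl | rfl
      exacts [⟨Sum.inl (), rfl⟩, ⟨Sum.inr (), rfl⟩]
  · push Not at hK
    have hleaf : ∀ v, ¬ (∀ y, H.Adj v y ↔ y = σ v) → ∀ y, H.Adj (σ v) y ↔ y = v :=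
      fun v hv => (hσ v).resolve_left hv
    refine hH.exists_iso_corona_of_pendant (ι := {v // ¬ ∀ y, H.Adj v y ↔ y = σ v})
      (f := Subtype.val) (l := fun v => σ v) ⟨?_, ?_⟩ fun i => hleaf i i.2
    · have hne : ∀ u v : {v // ¬ ∀ y, H.Adj v y ↔ y = σ v}, u.1 ≠ σ v := by
        rintro ⟨u, hu⟩ ⟨v, hv⟩ (rfl : u = σ v)
        have h1 := hleaf v hv
        have h2 := (h1 _).1 (hadj (σ v))
        exact hu (by rwa [h2])
      rintro (u | u) (v | v) huv
      · exact congrArg _ (Subtype.ext huv)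
      · exact absurd huv (hne _ _)
      · exact absurd huv.symm (hne _ _)
      · exact congrArg _ (Subtype.ext (σ.injective huv))
    · intro x
      by_cases hx : ∀ y, H.Adj x y ↔ y = σ x
      -- If `σ⁻¹ x` were a leaf as well as `x`, the edge between them would be the excluded `K₂`.
      · have hs : ¬ ∀ y, H.Adj (σ.symm x) y ↔ y = σ (σ.symm x) := fun hc => by
          obtain ⟨y, hy⟩ := hK _ hc
          simp only [Equiv.apply_symm_apply] at hy hc
          have hxs : σ.symm x = σ x := by
            rw [← hx]
            simpa using (hadj (σ.symm x)).symm
          rw [hx, ← hxs] at hy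
          rcases hy with h | h
          exacts [h.2 h.1, h.1 h.2]
        exact ⟨Sum.inr ⟨_, hs⟩, by simp⟩
      · exact ⟨Sum.inl ⟨x, hx⟩, rfl⟩

theorem exists_adj_adj_of_pendant (hH : H.Connected) (hc : 3 ≤ Nat.card W) {h h' : W}
    (hh : ∀ y, H.Adj h y ↔ y = h') : ∃ z, z ≠ h ∧ H.Adj h' z := by
  by_contra! hno
  have hall := hH.mem_of_forall_adj (S := {h, h'}) (x := h) (by simp) (by
    rintro x (rfl | rfl) y hy
    · exact Or.inr ((hh y).1 hy)
    · by_contra hy'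
      exact hno y (fun e => hy' (Or.inl e)) hy)
  have h1 : (Set.univ : Set W) = {h, h'} := (Set.eq_univ_of_forall hall).symm
  have h2 := Set.ncard_pair (((hh h').2 rfl).ne)
  rw [← h1, Set.ncard_univ] at h2
  omega

/-- Its role is to let the two factors be swapped. -/
theorem ExchangeBound.of_iso {X : SimpleGraph V} {Y : SimpleGraph W}
    (e : X ≃g Y) (h : X.ExchangeBound) : Y.ExchangeBound := by
  have hN : ∀ A : Set W, X.closedNbhd (e.symm '' A) = e ⁻¹' Y.closedNbhd A := fun A => by
    ext x
    simp only [mem_closedNbhd, Set.mem_preimage]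
    refine or_congr ⟨?_, fun h => ⟨_, h, by simp⟩⟩ ⟨?_, ?_⟩
    · rintro ⟨y, hy, rfl⟩
      simpa
    · rintro ⟨_, ⟨y, hy, rfl⟩, hyx⟩
      exact ⟨y, hy, by simpa using e.map_adj_iff.2 hyx⟩
    · rintro ⟨y, hy, hyx⟩
      exact ⟨_, ⟨y, hy, rfl⟩, by simpa using e.symm.map_adj_iff.2 hyx⟩
  intro A B hA hAB
  have := h (e.symm '' A) (e.symm '' B) ?_ ?_
  · simpa [Set.ncard_image_of_injective _ e.symm.injective] using this
  · rintro _ ⟨x, hx, rfl⟩ _ ⟨y, hy, rfl⟩ _ hxy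
    exact hA.not_adj hx hy (e.symm.map_adj_iff.1 hxy)
  · rw [hN, hN]
    exact Set.preimage_mono hAB

theorem Connected.eq_top_of_forall_adj (hG : G.Connected)
    (h : ∀ x y z, G.Adj x y → G.Adj y z → x ≠ z → G.Adj x z) : G = ⊤ := by
  ext x y
  rw [top_adj]
  refine ⟨Adj.ne, fun hxy => ?_⟩
  refine (hG.mem_of_forall_adj (S := {y | y = x ∨ G.Adj x y}) (Or.inl rfl) ?_ y).resolve_left
    hxy.symm
  rintro u (rfl | hu) v huv
  · exact Or.inr huv
  · by_cases hv : v = x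
    · exact Or.inl hv
    · exact Or.inr (h x u v hu huv (Ne.symm hv))

/-! ### Eliminating pendant vertices and induced paths -/

section Pendant

variable [Finite V] [Finite W]

/-- A pendant vertex of `H` transfers the bound for `G × H` to `K₂ × G`. -/
theorem ExchangeBound.doubleCoverBound_of_pendant [Nonempty V] (hG : ∀ v, ∃ v', G.Adj v v')
    (hE : (H.directProd G).ExchangeBound)
    {h h' : W} (hh : ∀ y, H.Adj h y ↔ y = h') : G.DoubleCoverBound := by
  have hhh := (hh h').2 rfl
  obtain ⟨M, hM, hind, hdom⟩ := exists_maximal_isIndepSet (G := H) (A := {h'})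
    (Set.pairwise_singleton _ _)
  have hmem : h' ∈ M := hM rfl
  have hnot : h ∉ M := fun hc => hind.not_adj hc hmem hhh
  have hJ : H.IsIndepSet (insert h (M \ {h'})) := by
    refine Set.Pairwise.insert (hind.mono Set.sdiff_subset) fun y hy _ => ?_
    have : ¬ H.Adj h y := fun hc => hy.2 ((hh y).1 hc)
    exact ⟨this, fun hc => this hc.symm⟩
  -- With `J = M \ {h'}`, a vertex `z` missed by `J`, `h` and `h'` would make `J ∪ {h, z}`
  -- independent with `|M| + 1` elements, although `M × V` dominates.
  refine hE.doubleCoverBound hG hhh (fun hc => hnot hc.1) hJ fun z => ?_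
  by_contra! hz
  obtain ⟨hzh, hzh', hzM, hzadj⟩ := hz
  have hI : H.IsIndepSet (insert z (insert h (M \ {h'}))) := by
    refine Set.Pairwise.insert hJ fun y hy _ => ?_
    have : ¬ H.Adj y z := by
      rcases hy with rfl | hy
      exacts [fun hc => hzh' ((hh z).1 hc), hzadj y hy]
    exact ⟨fun hc => this hc.symm, this⟩
  have hle := hE.ncard_le_of_isDominatingSet (isIndepSet_prod_univ hI)
    (isDominatingSet_prod_univ hG hdom)
  rw [ncard_prod_univ, ncard_prod_univ, Set.ncard_insert_of_notMem,
    Set.ncard_insert_of_notMem (fun hc => hnot hc.1), Set.ncard_sdiff_singleton_add_one hmem] at hle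
  · have : 0 < Nat.card V := Nat.card_pos
    nlinarith
  · rintro (hc | hc)
    exacts [hzh hc, hzM hc]

theorem not_exchangeBound_of_cycleGraph_four (e : G ≃g cycleGraph 4) {h h' z : W}
    (hh' : H.Adj h h') (hz : H.Adj h' z) (hne : z ≠ h) (hzh : ¬ H.Adj h z) :
    ¬ (H.directProd G).ExchangeBound := by
  intro hE
  have hdom : ∀ x, ∃ y ∈ ({e.symm 0, e.symm 1} : Set V), G.Adj y x := fun x => by
    have : ∀ i : Fin 4, (cycleGraph 4).Adj 0 i ∨ (cycleGraph 4).Adj 1 i := by decide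
    rcases this (e x) with hc | hc
    · exact ⟨_, Or.inl rfl, by simpa using e.symm.map_adj_iff.2 hc⟩
    · exact ⟨_, Or.inr rfl, by simpa using e.symm.map_adj_iff.2 hc⟩
  -- The two ends of an edge totally dominate the 4-cycle, so 3 · 2 = 6 vertices replace 2 · 4 = 8.
  have hle := hE ({h, z} ×ˢ Set.univ) ({h, h', z} ×ˢ {e.symm 0, e.symm 1})
    (isIndepSet_prod_univ (isIndepSet_pair hzh)) ?_
  · have hcard : Nat.card V = 4 := by rw [Nat.card_congr e.toEquiv, Nat.card_fin]
    have h3 : ({h, h', z} : Set W).ncard ≤ 3 := by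
      have h1 := Set.ncard_insert_le h {h', z}
      have h2 := Set.ncard_insert_le h' {z}
      rw [Set.ncard_singleton] at h2
      omega
    have h2 : ({e.symm 0, e.symm 1} : Set V).ncard ≤ 2 := by
      have h1 := Set.ncard_insert_le (e.symm 0) {e.symm 1}
      rwa [Set.ncard_singleton] at h1
    rw [ncard_prod_univ, Set.ncard_prod, Set.ncard_pair hne.symm, hcard] at hle
    have := Nat.mul_le_mul h3 h2
    omega
  · rintro ⟨w, x⟩ hx
    rw [mem_closedNbhd] at hx ⊢
    obtain ⟨y, hy, hyx⟩ := hdom x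
    right
    rcases hx with ⟨rfl | rfl, -⟩ | ⟨⟨w', x'⟩, ⟨hw', -⟩, hww, -⟩
    · exact ⟨(h', y), ⟨by simp, hy⟩, hh'.symm, hyx⟩
    · exact ⟨(h', y), ⟨by simp, hy⟩, hz, hyx⟩
    · refine ⟨(w', y), ⟨?_, hy⟩, hww, hyx⟩
      rcases hw' with rfl | rfl <;> simp

/-- Let `L` be the leaves of `G`. Both `Lᶜ` and `{h}ᶜ` totally dominate their factors, so `Lᶜ ×
{h}ᶜ` dominates, yet it is smaller than the independent set `L × W` because `|Lᶜ| ≤ |L|`. -/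
theorem not_exchangeBound_of_perm (hG : G.Connected) (hV : 3 ≤ Nat.card V) {σ : Equiv.Perm V}
    (hσ : ∀ v, (∀ y, G.Adj v y ↔ y = σ v) ∨ ∀ y, G.Adj (σ v) y ↔ y = v) {h : W}
    (hH : ∀ w, ∃ w', w' ≠ h ∧ H.Adj w' w) : ¬ (G.directProd H).ExchangeBound := by
  intro hE
  have hadj : ∀ v, G.Adj v (σ v) := fun v => by
    rcases hσ v with h | h
    exacts [(h _).2 rfl, ((h _).2 rfl).symm]
  have hK : ∀ v, (∀ y, G.Adj v y ↔ y = σ v) → ¬ ∀ y, G.Adj (σ v) y ↔ y = v := fun v h1 h2 => by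
    obtain ⟨z, hz, hz'⟩ := exists_adj_adj_of_pendant hG hV h1
    exact hz ((h2 z).1 hz')
  set L : Set V := {v | ∀ y, G.Adj v y ↔ y = σ v} with hL
  have hmaps : ∀ v ∉ L, σ v ∈ L := fun v hv y => by
    have h1 := (hσ v).resolve_left hv
    have h2 := (h1 _).1 (hadj (σ v))
    rw [h1, h2]
  have hLc : Lᶜ.ncard ≤ L.ncard :=
    Set.ncard_le_ncard_of_injOn σ hmaps σ.injective.injOn (Set.toFinite L)
  have hind : G.IsIndepSet L := by
    intro u hu v hv _ huv
    obtain rfl := (hu v).1 huv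
    have h2 := (hv u).1 huv.symm
    exact hK u hu fun y => by rw [hv, ← h2]
  have htot : ∀ x, ∃ y ∈ Lᶜ, G.Adj y x := by
    intro x
    by_cases hx : x ∈ L
    · refine ⟨σ x, fun hc => hind.not_adj hx hc (hadj x), (hadj x).symm⟩
    · have h1 := (hσ x).resolve_left hx
      have h2 : ∃ y, G.Adj x y ∧ y ≠ σ x := by
        by_contra! hc
        exact hx fun y => ⟨hc y, fun hy => hy ▸ hadj x⟩
      obtain ⟨y, hxy, hy⟩ := h2
      refine ⟨y, fun hyL => hy ?_, hxy.symm⟩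
      have h3 := (hyL x).1 hxy.symm
      have h4 := (h1 _).1 (hadj (σ x))
      exact σ.injective (h3.symm.trans h4.symm)
  have hdom : (G.directProd H).IsDominatingSet (Lᶜ ×ˢ {h}ᶜ) := by
    rw [isDominatingSet_iff]
    rintro ⟨x, w⟩
    obtain ⟨y, hy, hyx⟩ := htot x
    obtain ⟨w', hw', hww⟩ := hH w
    exact Or.inr ⟨(y, w'), ⟨hy, hw'⟩, hyx, hww⟩
  have hle := hE.ncard_le_of_isDominatingSet (isIndepSet_prod_univ hind) hdom
  have h1 := Set.ncard_add_ncard_compl ({h} : Set W)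
  have h2 := Set.ncard_add_ncard_compl L
  rw [Set.ncard_singleton] at h1
  rw [ncard_prod_univ, Set.ncard_prod, ← h1] at hle
  have h3 : 0 < L.ncard := by omega
  have h4 := Nat.mul_le_mul_right ({h}ᶜ : Set W).ncard hLc
  nlinarith

theorem ExchangeBound.not_pendant [Nontrivial V] [Nontrivial W] (hG : G.Connected)
    (hH : H.Connected) (hV : 3 ≤ Nat.card V) (hW : 3 ≤ Nat.card W)
    (hE : (G.directProd H).ExchangeBound) (h h' : W) : ¬ ∀ y, H.Adj h y ↔ y = h' := by
  intro hh
  have hE' := hE.of_iso (directProdComm G H)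
  obtain ⟨z, hzh, hz⟩ := exists_adj_adj_of_pendant hH hW hh
  have hhh := (hh h').2 rfl
  rcases (hE'.doubleCoverBound_of_pendant hG.exists_adj hh).cycleGraph_or_pendant hG
    with ⟨⟨e⟩⟩ | ⟨σ, hσ⟩
  · exact not_exchangeBound_of_cycleGraph_four e hhh hz hzh
      (fun hc => hz.ne ((hh z).1 hc).symm) hE'
  · refine not_exchangeBound_of_perm hG hV hσ (h := h) (fun w => ?_) hE
    by_cases hw : w = h'
    · exact ⟨z, hzh, hw ▸ hz.symm⟩
    · obtain ⟨y, hy⟩ := hH.exists_adj w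
      refine ⟨y, ?_, hy.symm⟩
      rintro rfl
      exact hw ((hh w).1 hy.symm)

/-- If `H` has no pendant vertex, then `G` has no induced path on three vertices. -/
theorem ExchangeBound.adj_of_adj_adj [Nontrivial W] (hH : H.Connected)
    (hno : ∀ h h', ¬ ∀ y, H.Adj h y ↔ y = h') (hE : (G.directProd H).ExchangeBound)
    {x y z : V} (hxy : G.Adj x y) (hyz : G.Adj y z) (hxz : x ≠ z) : G.Adj x z := by
  by_contra hn
  have htot : ∀ a w, ∃ w' ∈ ({a}ᶜ : Set W), H.Adj w' w := fun a w => by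
    by_contra! hc
    have h1 : ∀ y, H.Adj w y → y = a := fun y hy => by
      by_contra hya
      exact hc y hya hy.symm
    obtain ⟨y, hy⟩ := hH.exists_adj w
    exact hno w a fun u => ⟨h1 u, fun hu => by rw [hu, ← h1 y hy]; exact hy⟩
  obtain ⟨a⟩ := hH.nonempty
  obtain ⟨b, hab⟩ := hH.exists_adj a
  -- Without leaves, `{a}ᶜ` totally dominates `H`. Dropping `(x, a)` and `(z, a)` therefore loses
  -- only these two vertices, and the single vertex `(y, b)` covers both.
  have hle := hE ({x, z} ×ˢ Set.univ) ({x, z} ×ˢ {a}ᶜ ∪ {y} ×ˢ {b})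
    (isIndepSet_prod_univ (isIndepSet_pair hn)) ?_
  · have h1 := Set.ncard_union_le (({x, z} : Set V) ×ˢ ({a}ᶜ : Set W)) ({y} ×ˢ {b})
    have h2 := Set.ncard_add_ncard_compl ({a} : Set W)
    rw [Set.ncard_singleton] at h2
    rw [ncard_prod_univ, Set.ncard_pair hxz] at hle
    simp only [Set.ncard_prod, Set.ncard_pair hxz, Set.ncard_singleton] at h1
    omega
  · rintro ⟨v, w⟩ hv
    rw [mem_closedNbhd] at hv ⊢
    rcases hv with ⟨hv, -⟩ | ⟨⟨v', w'⟩, ⟨hv', -⟩, hvv, -⟩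
    · by_cases hw : w = a
      · refine Or.inr ⟨(y, b), Or.inr ⟨rfl, rfl⟩, ?_, hw ▸ hab.symm⟩
        rcases hv with rfl | rfl
        exacts [hxy.symm, hyz]
      · exact Or.inl (Or.inl ⟨hv, hw⟩)
    · obtain ⟨u, hu, huw⟩ := htot a w
      exact Or.inr ⟨(v', u), Or.inl ⟨hv', hu⟩, hvv, huw⟩

theorem ExchangeBound.card_le_three_of_top [Nontrivial V] [Nontrivial W]
    (hE : ((⊤ : SimpleGraph V).directProd (⊤ : SimpleGraph W)).ExchangeBound) :
    Nat.card W ≤ 3 := by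
  obtain ⟨g, g', hg⟩ := exists_pair_ne V
  obtain ⟨h, h', hh⟩ := exists_pair_ne W
  -- The vertex `(g, h)` covers everything off its row and column; `(g', h)` covers the rest of the
  -- row of `g`, and `(g, h')` the rest of the column of `h`.
  have hle := hE.ncard_le_of_isDominatingSet (A := {g} ×ˢ Set.univ)
    (B := {(g, h), (g, h'), (g', h)}) (isIndepSet_prod_univ (Set.pairwise_singleton _ _)) ?_
  · rw [ncard_prod_univ, Set.ncard_singleton, one_mul] at hle
    have h1 := Set.ncard_insert_le (g, h) {(g, h'), (g', h)}
    have h2 := Set.ncard_insert_le (g, h') {(g', h)}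
    rw [Set.ncard_singleton] at h2
    omega
  · rw [isDominatingSet_iff]
    rintro ⟨x, w⟩
    by_cases hx : x = g
    · subst hx
      by_cases hw : w = h
      · subst hw
        exact Or.inl (by simp)
      · exact Or.inr ⟨(g', h), by simp, hg.symm, Ne.symm hw⟩
    · by_cases hw : w = h
      · subst hw
        exact Or.inr ⟨(g, h'), by simp, Ne.symm hx, hh.symm⟩
      · exact Or.inr ⟨(g, h), by simp, Ne.symm hx, Ne.symm hw⟩

theorem ExchangeBound.nonempty_iso_K3_K3 [Nontrivial V] [Nontrivial W] (hG : G.Connected)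
    (hH : H.Connected) (hV : 3 ≤ Nat.card V) (hW : 3 ≤ Nat.card W)
    (hE : (G.directProd H).ExchangeBound) :
    Nonempty (G.directProd H ≃g
      (⊤ : SimpleGraph (Fin 3)).directProd (⊤ : SimpleGraph (Fin 3))) := by
  have hE' := hE.of_iso (directProdComm G H)
  have hG' := hG.eq_top_of_forall_adj fun x y z =>
    hE.adj_of_adj_adj hH (hE.not_pendant hG hH hV hW)
  have hH' := hH.eq_top_of_forall_adj fun x y z =>
    hE'.adj_of_adj_adj hG (hE'.not_pendant hH hG hW hV)
  subst hG' hH'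
  have h1 := le_antisymm hE.card_le_three_of_top hW
  have h2 := le_antisymm hE'.card_le_three_of_top hV
  exact ⟨directProdCongr (Iso.completeGraph (Finite.equivFinOfCardEq h2))
    (Iso.completeGraph (Finite.equivFinOfCardEq h1))⟩

/-! ### A factor of order two, and the theorem -/

theorem ExchangeBound.nonempty_iso_of_card_eq_two [Nontrivial V] [Nontrivial W]
    (hG : G.Connected) (hH : H.Connected) (hV : Nat.card V = 2)
    (hE : (G.directProd H).ExchangeBound) :
    Nonempty (G.directProd H ≃g (⊤ : SimpleGraph (Fin 2)).directProd (cycleGraph 4)) ∨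
      ∃ (n : ℕ) (F : SimpleGraph (Fin n)), F.Connected ∧
        Nonempty (G.directProd H ≃g (⊤ : SimpleGraph (Fin 2)).directProd F.corona) := by
  obtain ⟨p⟩ := hG.nonempty
  obtain ⟨q, hpq⟩ := hG.exists_adj p
  have hall : ∀ x, x = p ∨ x = q := fun x => by
    have h1 : ({p, q} : Set V) = Set.univ :=
      Set.eq_of_subset_of_ncard_le (Set.subset_univ _) (by
        rw [Set.ncard_univ, hV, Set.ncard_pair hpq.ne])
    simpa using h1.symm.subset (Set.mem_univ x)
  have hG' : G = ⊤ := by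
    ext x y
    rw [top_adj]
    refine ⟨Adj.ne, fun hxy => ?_⟩
    rcases hall x with rfl | rfl <;> rcases hall y with rfl | rfl
    exacts [absurd rfl hxy, hpq, hpq.symm, absurd rfl hxy]
  have hB := hE.doubleCoverBound hH.exists_adj hpq (J := ∅) (fun h => h)
    (by simp) fun x =>
      (hall x).imp_right Or.inl
  subst hG'
  have e : (⊤ : SimpleGraph V) ≃g (⊤ : SimpleGraph (Fin 2)) :=
    Iso.completeGraph (Finite.equivFinOfCardEq hV)
  rcases hB.cycleGraph_or_pendant hH with ⟨⟨f⟩⟩ | ⟨σ, hσ⟩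
  · exact Or.inl ⟨directProdCongr e f⟩
  · obtain ⟨n, F, hF, ⟨f⟩⟩ := hH.exists_iso_corona_of_perm hσ
    exact Or.inr ⟨n, F, hF, ⟨directProdCongr e f⟩⟩

end Pendant
end SimpleGraph

theorem theorem1p2 {V : Type*} {W : Type*} [Finite V] [Finite W] [Nontrivial V] [Nontrivial W]
    (G : SimpleGraph V) (H : SimpleGraph W) (hG : G.Connected) (hH : H.Connected) :
    (G.directProd H).IsWellDominated ↔
      Nonempty (G.directProd H ≃g
        (⊤ : SimpleGraph (Fin 3)).directProd (⊤ : SimpleGraph (Fin 3))) ∨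
      Nonempty (G.directProd H ≃g
        (⊤ : SimpleGraph (Fin 2)).directProd (SimpleGraph.cycleGraph 4)) ∨
      ∃ (n : ℕ) (F : SimpleGraph (Fin n)), F.Connected ∧
        Nonempty (G.directProd H ≃g (⊤ : SimpleGraph (Fin 2)).directProd F.corona) := by
  constructor
  · intro h
    have hE := h.exchangeBound
    have hV : 1 < Nat.card V := Finite.one_lt_card
    have hW : 1 < Nat.card W := Finite.one_lt_card
    by_cases hV2 : Nat.card V = 2
    · exact Or.inr (hE.nonempty_iso_of_card_eq_two hG hH hV2)
    by_cases hW2 : Nat.card W = 2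
    · let e := SimpleGraph.directProdComm G H
      rcases (hE.of_iso e).nonempty_iso_of_card_eq_two hH hG hW2 with
        ⟨⟨f⟩⟩ | ⟨n, F, hF, ⟨f⟩⟩
      · exact Or.inr (Or.inl ⟨e.trans f⟩)
      · exact Or.inr (Or.inr ⟨n, F, hF, ⟨e.trans f⟩⟩)
    · exact Or.inl (hE.nonempty_iso_K3_K3 hG hH (by omega) (by omega))
  · rintro (⟨⟨e⟩⟩ | ⟨⟨e⟩⟩ | ⟨n, F, -, ⟨e⟩⟩)
    · exact SimpleGraph.isWellDominated_K3_K3.of_iso e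
    · exact SimpleGraph.isWellDominated_K2_C4.of_iso e
    · exact (SimpleGraph.isWellDominated_directProd_corona F).of_iso e
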